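/- Let $\mathcal{E}$ and $\mathcal{E}'$ be two ellipses (circles allowed) in the plane $\mathbb{C}$, with $\mathcal{E}'$ contained in the open region bounded by $\mathcal{E}$. Let $\mathcal{T}$ be the family of all nondegenerate triangles inscribed in $\mathcal{E}$ whose three side lines are tangent to $\mathcal{E}'$, and suppose that $\mathcal{T}$ is non-empty. Let $\mathcal{A}:\mathbb{C}\to\mathbb{C}$ be a real-affine bijection taking the unit circle to $\mathcal{E}$, let $f,g$ be the foci of the ellipse $\mathcal{A}^{-1}(\mathcal{E}')$, and put $$P_3=\mathcal{A}\!\left(\frac{f+g-(\overline f+\overline g)fg}{1-|f|^2|g|^2}\right);$$ when $\mathcal{A}(z)=pz+q\overline z$ with $p,q$ real this is $$P_3=\frac{(g|f|^2+f|g|^2-f-g)\,p+(|f|^2\overline g+\overline f|g|^2-\overline f-\overline g)\,q}{|f|^2|g|^2-1}.$$ For $T\in\mathcal{T}$ denote its circumcenter by $X_3$. Let $O=P_3$. Then there is a constant $\Pi_3\neq 0$ such that the power of $O$ with respect to the circumcircle of $T$ equals $\Pi_3$ for every $T\in\mathcal{T}$. Moreover, for every $r>0$, let $s$ be the nonzero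 real number given by $1/s=\Pi_3/r^2$. For every $T\in\mathcal{T}$ no vertex of $T$ equals $O$, the inverses of the three vertices of $T$ in the circle with center $O$ and radius $r$ form a nondegenerate triangle $T'$, and the circumcenter $X_3'$ of $T'$ satisfies $$X_3'=O+s\,(X_3-O).$$ Consequently the locus of $X_3'$ over $\mathcal{T}$ is the image of the locus of $X_3$ over $\mathcal{T}$ under the homothety with center $O$ and ratio $s$. -/

import Mathlib

open scoped ComplexConjugate

noncomputable section

/-- The locus of points of the plane whose distances to `f` and `g` add up to `l`: for
`dist f g < l` this is the ellipse with foci `f`, `g` and major axis of length `l`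
(a circle if `f = g`). -/
def focalEllipse (f g : ℂ) (l : ℝ) : Set ℂ :=
  {z | dist z f + dist z g = l}

/-- The Poncelet triangles of the pair of ellipses `E`, `E'`: the nondegenerate triangles with
vertices on `E` all of whose side lines are tangent to `E'`, that is, meet `E'` in exactly one
point. (If `E'` is nested in `E`, the point of tangency lies on the side itself.) -/
def ponceletTriangles (E E' : Set ℂ) : Set (Affine.Triangle ℝ ℂ) :=
  {T | (∀ i, T.points i ∈ E) ∧
    ∀ i j, i ≠ j → ∃! z, z ∈ line[ℝ, T.points i, T.points j] ∧ z ∈ E'}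

/-- `T'` is the inversive triangle of `T`: its vertices are the inverses of the vertices of `T`
in the circle with centre `O` and radius `r`. -/
def IsInversiveTriangle (O : ℂ) (r : ℝ) (T T' : Affine.Triangle ℝ ℂ) : Prop :=
  ∀ i, T.points i ≠ O ∧ T'.points i = EuclideanGeometry.inversion O r (T.points i)

/-- The locus of the circumcentre over a family of triangles. -/
def circumcenterLocus (F : Set (Affine.Triangle ℝ ℂ)) : Set ℂ :=
  {X | ∃ T ∈ F, X = T.circumcenter}

/-- The locus of the circumcentre of the inversive triangle over a family of triangles. -/
def inversiveCircumcenterLocus (O : ℂ) (r : ℝ) (F : Set (Affine.Triangle ℝ ℂ)) : Set ℂ :=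
  {X | ∃ T ∈ F, ∃ T', IsInversiveTriangle O r T T' ∧ X = T'.circumcenter}

/-- The point `P₃` of the pair of ellipses that are the images under the affine map `A` of the
unit circle and of an ellipse with foci `f`, `g`. If `A z = p * z + q * conj z`, it is
`(g|f|² + f|g|² - f - g) p / (|f|²|g|² - 1) + (|f|² conj g + |g|² conj f - conj f - conj g) q /
(|f|²|g|² - 1)`. -/
def pointP3 (A : ℂ ≃ᵃ[ℝ] ℂ) (f g : ℂ) : ℂ :=
  A ((f + g - (conj f + conj g) * f * g) / (1 - (‖f‖ * ‖g‖) ^ 2 : ℝ))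

end

/-! In the frame of `A` the outer ellipse is the unit circle and, up to translation, `A z = p z + q
z̄`. A chord is tangent to the inner ellipse only if the mirror image of one focus in it lies at
distance `l` from the other. Hence the vertices `z` of a Poncelet triangle satisfy `z (z - f)(z - g)
= λ (1 - f̄ z)(1 - ḡ z)`, where `λ`, the product of the vertices, is the only quantity depending on
the triangle (`blaschke_relation`).

With `z z̄ = 1` this expresses `z²` through `1`, `z`, `z̄`. So `|A z - A o|²` agrees at the vertices
with a real-affine function of `z`, which gives the equation of the circumcircle; the value of that
function at `o` is minus the power of `A o` (`circle_equation`). In this value `λ` multiplies the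
conjugate of `o + ō f g - f - g`, which vanishes for `A o = P₃`. The power is therefore constant,
and it is negative by `norm_mul_sub_lt` and `power_neg`.

Inversion about a point of power `k ≠ 0` sends a circle to its image under the homothety of ratio
`r² / k` (`exists_inversiveTriangle`), so constant power means a common ratio. -/

/-! ### Tangent lines of an ellipse and reflection of a focus. -/

open Filter Topology in
/-- If the line through `a` with direction `v` meets the ellipse with foci `f`, `g` in exactly one
point, then no point of the line lies inside the ellipse. -/
theorem le_dist_add_dist_of_existsUnique {f g a v : ℂ} {l : ℝ} (hv : v ≠ 0)
    (h : ∃! t : ℝ, dist (a + t * v) f + dist (a + t * v) g = l) (t : ℝ) :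
    l ≤ dist (a + t * v) f + dist (a + t * v) g := by
  by_contra! hlt
  set F : ℝ → ℝ := fun t => dist (a + t * v) f + dist (a + t * v) g with hF
  have hcont : Continuous F := by fun_prop
  have hvpos : 0 < ‖v‖ := norm_pos_iff.mpr hv
  have hbound : ∀ s : ℝ, |s| * ‖v‖ - ‖a - f‖ ≤ F s := fun s => by
    have h1 : ‖(s : ℂ) * v‖ ≤ ‖a + s * v - f‖ + ‖a - f‖ := by
      have := norm_sub_le (a + s * v - f) (a - f)
      rwa [show a + s * v - f - (a - f) = s * v by ring] at this
    rw [norm_mul, Complex.norm_real, Real.norm_eq_abs] at h1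
    have h2 : 0 ≤ dist (a + s * v) g := dist_nonneg
    simp only [hF, Complex.dist_eq] at h2 ⊢
    linarith
  -- Large enough that `±R` lie on either side of `t` and the linear lower bound for `F` has reached
  -- `l` there.
  set R : ℝ := |t| + |(l + ‖a - f‖) / ‖v‖| + 1 with hR
  have hlarge : ∀ s : ℝ, |s| = R → l ≤ F s := fun s hs => by
    refine le_trans ?_ (hbound s)
    have h1 : (l + ‖a - f‖) / ‖v‖ ≤ R :=
      (le_abs_self _).trans (by rw [hR]; linarith [abs_nonneg t])
    rw [div_le_iff₀ hvpos] at h1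
    rw [hs]; linarith
  have hRpos : 0 < R := by positivity
  have htR : |t| < R := by rw [hR]; linarith [abs_nonneg ((l + ‖a - f‖) / ‖v‖)]
  rw [abs_lt] at htR
  obtain ⟨s₁, hs₁, hs₁'⟩ := intermediate_value_Icc htR.2.le hcont.continuousOn
    ⟨hlt.le, hlarge R (abs_of_pos hRpos)⟩
  obtain ⟨s₂, hs₂, hs₂'⟩ := intermediate_value_Icc' htR.1.le hcont.continuousOn
    ⟨hlt.le, hlarge (-R) (by rw [abs_neg, abs_of_pos hRpos])⟩
  -- The two solutions lie on opposite sides of `t`; being equal, they are `t`, where the value is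
  -- below `l`.
  have heq : s₁ = s₂ := h.unique hs₁' hs₂'
  have : s₁ = t := le_antisymm (heq ▸ hs₂.2) hs₁.1
  rw [this] at hs₁'
  exact hlt.ne hs₁'

/-- The line through `a` with direction `v` meets the segment between two points on different
sides of it. -/
theorem exists_dist_add_dist_eq {a v x y : ℂ} (hv : v ≠ 0)
    (h : ((x - a) * conj v).im * ((y - a) * conj v).im ≤ 0) :
    ∃ t : ℝ, dist (a + t * v) x + dist (a + t * v) y = dist x y := by
  obtain ⟨c, hc0, hc1, hc⟩ : ∃ c : ℝ, 0 ≤ c ∧ c ≤ 1 ∧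
      (1 - c) * ((x - a) * conj v).im + c * ((y - a) * conj v).im = 0 := by
    set α := ((x - a) * conj v).im
    set β := ((y - a) * conj v).im
    by_cases hα : α = 0
    · exact ⟨0, le_rfl, zero_le_one, by simp [hα]⟩
    have hpos : 0 < α ^ 2 - α * β := by have := sq_pos_of_ne_zero hα; linarith
    -- This is the zero `α / (α - β)` of the affine interpolation, expanded by `α` to make the
    -- denominator positive.
    refine ⟨α ^ 2 / (α ^ 2 - α * β), by positivity, ?_, ?_⟩
    · rw [div_le_one hpos]; linarith
    · rw [one_sub_div hpos.ne', div_mul_eq_mul_div, div_mul_eq_mul_div, ← add_div, div_eq_zero_iff]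
      left; ring
  set w : ℂ := (1 - c) * x + c * y with hw
  have hwv : ((w - a) * conj v).im = 0 := by
    rw [← hc, hw]
    simp [Complex.mul_im, Complex.mul_re]
    ring
  refine ⟨((w - a) * conj v).re / Complex.normSq v, ?_⟩
  have hN : (Complex.normSq v : ℂ) ≠ 0 := by simpa using hv
  have hre : ((((w - a) * conj v).re : ℝ) : ℂ) = (w - a) * conj v :=
    Complex.ext (by simp) (by simpa using hwv.symm)
  have hmem : a + ((((w - a) * conj v).re / Complex.normSq v : ℝ) : ℂ) * v = w := by
    rw [Complex.ofReal_div, hre]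
    have := Complex.mul_conj v
    field_simp
    linear_combination (w - a) * this
  rw [hmem, dist_comm w x]
  refine dist_add_dist_of_mem_segment ⟨1 - c, c, by linarith, hc0, by ring, ?_⟩
  simp [hw]

/-- A chord of the unit circle which meets an ellipse in exactly one point: the reflection of one
focus in the chord is at distance `l` from the other focus. -/
theorem norm_reflection_sub_of_tangent {a b f g : ℂ} {l : ℝ} (ha : a * conj a = 1)
    (hb : b * conj b = 1) (hab : a ≠ b) (hl : dist f g < l)
    (h : ∃! t : ℝ, dist (a + t * (b - a)) f + dist (a + t * (b - a)) g = l) :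
    ‖a + b - a * b * conj f - g‖ = l := by
  have hv : b - a ≠ 0 := sub_ne_zero.mpr hab.symm
  have hle := le_dist_add_dist_of_existsUnique hv h
  have hna : ‖a‖ = 1 := by
    have := congrArg norm ha
    simp only [norm_mul, Complex.norm_conj, norm_one] at this
    nlinarith [norm_nonneg a]
  have hnb : ‖b‖ = 1 := by
    have := congrArg norm hb
    simp only [norm_mul, Complex.norm_conj, norm_one] at this
    nlinarith [norm_nonneg b]
  set f' := a + b - a * b * conj f with hf'
  -- Reflection in the chord `ab` of the unit circle is `w ↦ a + b - a b w̄`.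
  have hrefl : ∀ t : ℝ, dist (a + t * (b - a)) f = dist (a + t * (b - a)) f' := fun t => by
    have key : f' - (a + t * (b - a)) = a * b * conj (a + t * (b - a) - f) := by
      simp only [map_add, map_sub, map_mul, Complex.conj_ofReal, hf']
      linear_combination (t * b - b) * ha - t * a * hb
    rw [dist_comm _ f', Complex.dist_eq, Complex.dist_eq, key, norm_mul, norm_mul,
      Complex.norm_conj, hna, hnb, one_mul, one_mul]
  have hside : ((f' - a) * conj (b - a)).im = -((f - a) * conj (b - a)).im := by
    have key : (f' - a) * conj (b - a) = conj ((f - a) * conj (b - a)) := by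
      simp only [map_mul, map_sub, Complex.conj_conj, hf']
      linear_combination (1 - a * conj f) * hb + (b * conj f - 1) * ha
    rw [key, Complex.conj_im]
  rw [← Complex.dist_eq]
  apply le_antisymm
  · obtain ⟨t, ht, -⟩ := h
    rw [← ht]
    simp only [hrefl]
    exact dist_triangle_left _ _ _
  -- Foci not strictly on the same side would give a point of the line with distance sum `dist f g <
  -- l`. Otherwise `f'` and `g` are separated by the line, and the crossing point has distance sum
  -- `dist f' g`.
  · by_cases hfg : ((f - a) * conj (b - a)).im * ((g - a) * conj (b - a)).im ≤ 0
    · obtain ⟨t, ht⟩ := exists_dist_add_dist_eq hv hfg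
      linarith [hle t]
    · obtain ⟨t, ht⟩ := exists_dist_add_dist_eq (x := f') (y := g) hv
        (by rw [hside]; linarith [not_le.mp hfg])
      rw [← ht, ← hrefl]
      exact hle t

/-! ### Foci, Blaschke relation and affine coefficients. -/

/-- The foci of an ellipse in the open unit disc lie in the disc. -/
theorem norm_focus_lt_one {f g : ℂ} {l : ℝ} (hl : dist f g < l)
    (h : focalEllipse f g l ⊆ Metric.ball (0 : ℂ) 1) : ‖f‖ < 1 := by
  obtain ⟨u, hu, d, hd, hfg⟩ : ∃ u : ℂ, ‖u‖ = 1 ∧ ∃ d : ℝ, 0 ≤ d ∧ g = f + d * u := by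
    by_cases hfg : g = f
    · exact ⟨1, by simp, 0, le_rfl, by simp [hfg]⟩
    · have h0 : (‖g - f‖ : ℂ) ≠ 0 := by simpa [sub_eq_zero] using hfg
      refine ⟨(g - f) / ‖g - f‖, ?_, ‖g - f‖, norm_nonneg _, ?_⟩
      · rw [norm_div, Complex.norm_real, norm_norm]
        exact div_self (by exact_mod_cast h0)
      · field_simp; ring
  have hdl : d < l := by
    rwa [hfg, dist_comm, Complex.dist_eq, add_sub_cancel_left, norm_mul, hu, mul_one,
      Complex.norm_real, Real.norm_eq_abs, abs_of_nonneg hd] at hl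
  have hmul : ∀ r : ℝ, ‖(r : ℂ) * u‖ = |r| := fun r => by
    rw [norm_mul, hu, mul_one, Complex.norm_real, Real.norm_eq_abs]
  -- The two points are the ends of the major axis; `f` is a convex combination of them.
  have h1 : f + (((l + d) / 2 : ℝ) : ℂ) * u ∈ focalEllipse f g l := by
    rw [focalEllipse, Set.mem_ofPred_eq, hfg, Complex.dist_eq, Complex.dist_eq,
      add_sub_cancel_left, add_sub_add_left_eq_sub, ← sub_mul, ← Complex.ofReal_sub, hmul, hmul,
      abs_of_nonneg (by linarith), abs_of_nonneg (by linarith)]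
    ring
  have h2 : f + ((-((l - d) / 2) : ℝ) : ℂ) * u ∈ focalEllipse f g l := by
    rw [focalEllipse, Set.mem_ofPred_eq, hfg, Complex.dist_eq, Complex.dist_eq,
      add_sub_cancel_left, add_sub_add_left_eq_sub, ← sub_mul, ← Complex.ofReal_sub, hmul, hmul,
      abs_of_nonpos (by linarith), abs_of_nonpos (by linarith)]
    ring
  have hlpos : 0 < l := by linarith
  have hmem := convex_ball (0 : ℂ) 1 (h h1) (h h2)
    (show 0 ≤ (l - d) / (2 * l) from div_nonneg (by linarith) (by linarith))
    (show 0 ≤ (l + d) / (2 * l) from div_nonneg (by linarith) (by linarith))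
    (by field_simp; ring)
  have heq : ((l - d) / (2 * l)) • (f + (((l + d) / 2 : ℝ) : ℂ) * u) +
      ((l + d) / (2 * l)) • (f + ((-((l - d) / 2) : ℝ) : ℂ) * u) = f := by
    have : (l : ℂ) ≠ 0 := by exact_mod_cast hlpos.ne'
    simp only [Complex.real_smul]
    push_cast
    field_simp
    ring
  rw [heq] at hmem
  simpa using hmem

/-- If the two sides of a triangle inscribed in the unit circle through the vertex `z` touch an
ellipse, the other two vertices satisfy the Blaschke relation. -/
theorem blaschke_relation {f g z a b : ℂ} {l : ℝ} (hz : z * conj z = 1) (ha : a * conj a = 1)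
    (hb : b * conj b = 1) (hab : a ≠ b) (h1 : ‖z + a - z * a * conj f - g‖ = l)
    (h2 : ‖z + b - z * b * conj f - g‖ = l) :
    a * b * ((1 - z * conj f) * (1 - z * conj g)) = (z - f) * (z - g) := by
  -- The squared condition times `z w` is a quadratic equation in `w`, with roots `a` and `b`.
  have aux : ∀ w : ℂ, w * conj w = 1 → ‖z + w - z * w * conj f - g‖ = l →
      (z + w - z * w * conj f - g) * (z + w - f - z * w * conj g) = l ^ 2 * (z * w) := by
    intro w hw h
    have h3 := Complex.mul_conj' (z + w - z * w * conj f - g)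
    rw [h] at h3
    simp only [map_sub, map_add, map_mul, Complex.conj_conj] at h3
    rw [← h3]
    linear_combination (-(z + w - z * w * conj f - g) * (w - w * conj w * f)) * hz
      - (z + w - z * w * conj f - g) * (z - f) * hw
  have e1 := aux a ha h1
  have e2 := aux b hb h2
  refine mul_left_cancel₀ (sub_ne_zero.mpr hab) ?_
  -- The linear term cancels, leaving the product of the roots.
  linear_combination b * e1 - a * e2

/-- A real-affine bijection of `ℂ` in terms of `z` and `conj z`. -/
theorem exists_coeff_affineEquiv (A : ℂ ≃ᵃ[ℝ] ℂ) :
    ∃ p q : ℂ, ‖p‖ ^ 2 ≠ ‖q‖ ^ 2 ∧ ∀ x y, A x - A y = p * (x - y) + q * conj (x - y) := by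
  set L := A.linear
  have hL : ∀ w : ℂ, L w = (L 1 - Complex.I * L Complex.I) / 2 * w +
      (L 1 + Complex.I * L Complex.I) / 2 * conj w := fun w => by
    have h1 : L w = w.re • L 1 + w.im • L Complex.I := by
      rw [← map_smul, ← map_smul, ← map_add]
      congr 1
      simp [Complex.re_add_im]
    rw [h1, Complex.real_smul, Complex.real_smul]
    have hw : conj w = w.re - w.im * Complex.I := by
      apply Complex.ext <;> simp
    rw [hw]
    conv_rhs => rw [← Complex.re_add_im w]
    simp only [Complex.add_re, Complex.add_im, Complex.mul_re, Complex.mul_im, Complex.ofReal_re,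
      Complex.ofReal_im, Complex.I_re, Complex.I_im, mul_zero, mul_one,
      add_zero, zero_add, sub_self]
    linear_combination (w.im * L Complex.I) * Complex.I_mul_I
  generalize (L 1 - Complex.I * L Complex.I) / 2 = p at hL
  generalize (L 1 + Complex.I * L Complex.I) / 2 = q at hL
  refine ⟨p, q, fun h => ?_, fun x y => ?_⟩
  · have hpq : p * conj p = q * conj q := by
      rw [Complex.mul_conj', Complex.mul_conj']; exact_mod_cast h
    -- `L` maps this element to `(|p|² - |q|²) w`.
    have hker : ∀ w : ℂ, conj p * w - q * conj w = 0 := fun w => by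
      rw [← map_eq_zero_iff L L.injective, hL]
      simp only [map_sub, map_mul, Complex.conj_conj]
      linear_combination w * hpq
    have h1 := hker 1
    have h2 := hker Complex.I
    rw [map_one] at h1
    rw [Complex.conj_I] at h2
    have hq : q = 0 := by
      have : (2 * Complex.I) * q = 0 := by linear_combination h2 - Complex.I * h1
      simpa using this
    have hp : p = 0 := by simpa [hq] using h1
    have : L 1 = 0 := by rw [hL, hp, hq]; simp
    exact one_ne_zero ((map_eq_zero_iff L L.injective).mp this)
  · rw [← hL]
    exact (A.toAffineMap.linearMap_vsub x y).symm

/-! ### The point `P₃` and its power. -/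

section PointP3

variable {f g o : ℂ}

/-- This equation is all that is used about `P₃`: it makes the power independent of `λ`. The
explicit formula comes from eliminating `conj o` between the equation and its conjugate. -/
theorem add_conj_mul_eq (hf : ‖f‖ < 1) (hg : ‖g‖ < 1)
    (ho : o = (f + g - (conj f + conj g) * f * g) / (1 - (‖f‖ * ‖g‖) ^ 2 : ℝ)) :
    o + conj o * f * g = f + g := by
  have hpos : 0 < 1 - (‖f‖ * ‖g‖) ^ 2 := by
    have : ‖f‖ * ‖g‖ < 1 := by nlinarith [norm_nonneg f, norm_nonneg g]
    have : 0 ≤ ‖f‖ * ‖g‖ := by positivity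
    nlinarith
  have hne : ((1 - (‖f‖ * ‖g‖) ^ 2 : ℝ) : ℂ) ≠ 0 := by exact_mod_cast hpos.ne'
  have hco : conj o = (conj f + conj g - (f + g) * conj f * conj g) /
      (1 - (‖f‖ * ‖g‖) ^ 2 : ℝ) := by
    rw [ho, map_div₀, Complex.conj_ofReal]
    simp
  have hval : ((1 - (‖f‖ * ‖g‖) ^ 2 : ℝ) : ℂ) = 1 - (f * conj f) * (g * conj g) := by
    rw [Complex.mul_conj', Complex.mul_conj']; push_cast; ring
  rw [hval] at hne hco ho
  rw [hco, ho, div_mul_eq_mul_div, div_mul_eq_mul_div, ← add_div, div_eq_iff hne]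
  ring

theorem normSq_sub_sub_normSq_one_sub (x y : ℂ) :
    ‖x - y‖ ^ 2 - ‖1 - conj x * y‖ ^ 2 = -((1 - ‖x‖ ^ 2) * (1 - ‖y‖ ^ 2)) := by
  have : (((‖x - y‖ ^ 2 - ‖1 - conj x * y‖ ^ 2 : ℝ)) : ℂ) =
      ((-((1 - ‖x‖ ^ 2) * (1 - ‖y‖ ^ 2)) : ℝ) : ℂ) := by
    push_cast
    simp only [← Complex.mul_conj', map_sub, map_mul, map_one, Complex.conj_conj]
    ring
  exact_mod_cast this

/-- The equation for `o` factors as `o - f = g (1 - ō f)` and `o - g = f (1 - ō g)`. Together with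
the identity for `|x - y|² - |1 - x̄ y|²` this gives `1 - |o|² = |1 - ō f| |1 - ō g|`, so the left
side is `|f g| (1 - |o|²)`. -/
theorem norm_mul_sub_lt (hf : ‖f‖ < 1) (hg : ‖g‖ < 1) (h : o + conj o * f * g = f + g) :
    ‖(o - f) * (o - g)‖ < 1 - ‖o‖ ^ 2 := by
  have hof : o - f = g * (1 - conj o * f) := by linear_combination h
  have hog : o - g = f * (1 - conj o * g) := by linear_combination h
  have h1 := normSq_sub_sub_normSq_one_sub o f
  have h2 := normSq_sub_sub_normSq_one_sub o g
  rw [hof, norm_mul, mul_pow] at h1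
  rw [hog, norm_mul, mul_pow] at h2
  have hf2 : 0 < 1 - ‖f‖ ^ 2 := by nlinarith [norm_nonneg f]
  have hg2 : 0 < 1 - ‖g‖ ^ 2 := by nlinarith [norm_nonneg g]
  have e1 : (1 - ‖o‖ ^ 2) * (1 - ‖f‖ ^ 2) = (1 - ‖g‖ ^ 2) * ‖1 - conj o * f‖ ^ 2 := by linarith
  have e2 : (1 - ‖o‖ ^ 2) * (1 - ‖g‖ ^ 2) = (1 - ‖f‖ ^ 2) * ‖1 - conj o * g‖ ^ 2 := by linarith
  have hne : 1 - conj o * f ≠ 0 := fun h0 => by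
    rw [h0, mul_zero, sub_eq_zero] at hof
    rw [hof, ← Complex.normSq_eq_conj_mul_self, Complex.normSq_eq_norm_sq] at h0
    have : 1 - ‖f‖ ^ 2 = 0 := by exact_mod_cast h0
    exact hf2.ne' this
  have hpos : 0 < 1 - ‖o‖ ^ 2 := by
    have : 0 < (1 - ‖o‖ ^ 2) * (1 - ‖f‖ ^ 2) := by
      rw [e1]; have := norm_pos_iff.mpr hne; positivity
    exact pos_of_mul_pos_left this hf2.le
  have hprod : 1 - ‖o‖ ^ 2 = ‖1 - conj o * f‖ * ‖1 - conj o * g‖ := by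
    rw [← sq_eq_sq₀ hpos.le (by positivity), mul_pow]
    refine mul_left_cancel₀ (mul_pos hf2 hg2).ne' ?_
    linear_combination (1 - ‖o‖ ^ 2) * (1 - ‖g‖ ^ 2) * e1 +
      (1 - ‖g‖ ^ 2) * ‖1 - conj o * f‖ ^ 2 * e2
  have hfg : ‖f‖ * ‖g‖ < 1 := by nlinarith [norm_nonneg f, norm_nonneg g]
  calc ‖(o - f) * (o - g)‖ = ‖f‖ * ‖g‖ * (1 - ‖o‖ ^ 2) := by
        rw [hof, hog, hprod]; simp only [norm_mul]; ring
    _ < 1 - ‖o‖ ^ 2 := by nlinarith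

/-- The quantity is at most `-(|p| - |q|)² (1 - |o|²)`. -/
theorem power_neg {p q : ℂ} (hpq : ‖p‖ ^ 2 ≠ ‖q‖ ^ 2) (h : ‖(o - f) * (o - g)‖ < 1 - ‖o‖ ^ 2) :
    (‖p‖ ^ 2 + ‖q‖ ^ 2) * (‖o‖ ^ 2 - 1) + 2 * (p * conj q * ((o - f) * (o - g))).re < 0 := by
  have h1 : (p * conj q * ((o - f) * (o - g))).re ≤ ‖p‖ * ‖q‖ * ‖(o - f) * (o - g)‖ := by
    refine (Complex.re_le_norm _).trans ?_
    rw [norm_mul, norm_mul p, Complex.norm_conj]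
  have h2 : ‖p‖ * ‖q‖ * ‖(o - f) * (o - g)‖ ≤ ‖p‖ * ‖q‖ * (1 - ‖o‖ ^ 2) := by gcongr
  have h3 : 0 < (‖p‖ - ‖q‖) ^ 2 := sq_pos_of_ne_zero fun h0 => hpq (by rw [sub_eq_zero.mp h0])
  have h4 : 0 < 1 - ‖o‖ ^ 2 := (norm_nonneg _).trans_lt h
  nlinarith [mul_pos h3 h4]

/-- The equation of the circle through the affine images of the three points of the unit circle
with the same value `lam` of the Blaschke product. -/
theorem circle_equation {p q X z lam : ℂ} (h : o + conj o * f * g = f + g)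
    (hz : z * conj z = 1)
    (hB : lam * conj z * ((1 - z * conj f) * (1 - z * conj g)) = (z - f) * (z - g))
    (hX : conj X * p + X * conj q = p * conj q * (f + g + lam * (conj f * conj g)) +
      conj p * q * conj lam - (p * conj p + q * conj q) * conj o - 2 * (p * conj q) * o) :
    ‖p * (z - o) + q * conj (z - o)‖ ^ 2 - 2 * (conj X * (p * (z - o) + q * conj (z - o))).re +
      ((‖p‖ ^ 2 + ‖q‖ ^ 2) * (‖o‖ ^ 2 - 1) + 2 * (p * conj q * ((o - f) * (o - g))).re) = 0 := by
  have hre : ∀ w : ℂ, ((2 * w.re : ℝ) : ℂ) = w + conj w := fun w => (Complex.add_conj w).symm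
  have h' := congrArg conj h
  have hX' := congrArg conj hX
  have hB' := congrArg conj hB
  rw [← Complex.ofReal_inj]
  rw [Complex.ofReal_add, Complex.ofReal_sub, Complex.ofReal_add, hre, hre]
  push_cast
  simp only [← Complex.mul_conj', map_add, map_sub, map_mul, map_one, Complex.conj_conj,
    map_ofNat] at h' hX' hB' ⊢
  set zc := conj z
  set oc := conj o
  set fc := conj f
  set gc := conj g
  set pc := conj p
  set qc := conj q
  set lc := conj lam
  -- `hB` and `hz` replace `z²` by an affine expression in `z`, `z̄`; `hX` matches the coefficient
  -- of `z - o`, and `h'` removes `λ` from the constant term.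
  linear_combination -(z - o) * hX - (zc - oc) * hX' + (p * pc + q * qc) * hz +
    p * qc * (lam * h' - hB + lam * (z * fc * gc - fc - gc) * hz) +
    pc * q * (lc * h - hB' + lc * (zc * f * g - f - g) * hz)

end PointP3

/-! ### Circumcircles, power of a point and inversion. -/

section Triangles

theorem affineSpan_triangle_eq_top (T : Affine.Triangle ℝ ℂ) :
    affineSpan ℝ (Set.range T.points) = ⊤ := by
  rw [T.independent.affineSpan_eq_top_iff_card_eq_finrank_add_one, Complex.finrank_real_complex]
  rfl

theorem norm_sub_sq_eq (w X : ℂ) :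
    ‖w - X‖ ^ 2 = ‖w‖ ^ 2 - 2 * (conj X * w).re + ‖X‖ ^ 2 := by
  simp only [← Complex.normSq_eq_norm_sq, Complex.normSq_apply, Complex.sub_re, Complex.sub_im,
    Complex.mul_re, Complex.conj_re, Complex.conj_im]
  ring

/-- A circle equation satisfied by the vertices of a triangle determines the power of a point. -/
theorem power_circumsphere_eq (T : Affine.Triangle ℝ ℂ) {O X : ℂ} {k : ℝ}
    (h : ∀ i, ‖T.points i - O‖ ^ 2 - 2 * (conj X * (T.points i - O)).re + k = 0) :
    T.circumsphere.power O = k := by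
  have hd : ∀ i, ‖T.points i - O - X‖ ^ 2 = ‖X‖ ^ 2 - k := fun i => by
    rw [norm_sub_sq_eq]; linarith [h i]
  have hd' : ∀ i, dist (T.points i) (O + X) = √(‖X‖ ^ 2 - k) := fun i => by
    rw [← hd i, Real.sqrt_sq (norm_nonneg _), Complex.dist_eq, sub_sub]
  have hmem : O + X ∈ affineSpan ℝ (Set.range T.points) := by
    rw [affineSpan_triangle_eq_top]; trivial
  have hc := T.eq_circumcenter_of_dist_eq hmem hd'
  have hr := T.eq_circumradius_of_dist_eq hmem hd'
  rw [EuclideanGeometry.Sphere.power, T.circumsphere_center, T.circumsphere_radius, ← hc, ← hr,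
    Real.sq_sqrt (by rw [← hd 0]; positivity), Complex.dist_eq, sub_add_cancel_left, norm_neg]
  ring

/-- With `w` a vertex and `X` the circumcenter, both relative to `O`, the circle is `|w|² - 2 Re(X̄
w) + k = 0`. Substituting this into the distance from `r² w / |w|²` to `(r² / k) X` removes `w`. -/
theorem exists_inversiveTriangle (T : Affine.Triangle ℝ ℂ) {O : ℂ} {k r : ℝ} (hk : k ≠ 0)
    (hr : 0 < r) (h : T.circumsphere.power O = k) :
    ∃ T' : Affine.Triangle ℝ ℂ, IsInversiveTriangle O r T T' ∧
      T'.circumcenter = O + (r ^ 2 / k) • (T.circumcenter - O) := by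
  rw [EuclideanGeometry.Sphere.power, T.circumsphere_center, T.circumsphere_radius,
    dist_comm, Complex.dist_eq] at h
  set X := T.circumcenter - O with hX
  have hP : ∀ i, ‖T.points i - O‖ ^ 2 - 2 * (conj X * (T.points i - O)).re + k = 0 := fun i => by
    have h1 := T.dist_circumcenter_eq_circumradius i
    have h2 := norm_sub_sq_eq (T.points i - O) X
    rw [Complex.dist_eq] at h1
    rw [hX, sub_sub_sub_cancel_right, h1] at h2
    rw [hX]
    linarith
  have hne : ∀ i, T.points i ≠ O := fun i hi => hk (by simpa [hi] using hP i)
  have hdist : ∀ i, dist (EuclideanGeometry.inversion O r (T.points i)) (O + (r ^ 2 / k) • X) =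
      √((r ^ 2 / k) ^ 2 * (‖X‖ ^ 2 - k)) := fun i => by
    have hn : 0 < ‖T.points i - O‖ := norm_pos_iff.mpr (sub_ne_zero.mpr (hne i))
    rw [Complex.dist_eq, ← Real.sqrt_sq (norm_nonneg _)]
    congr 1
    have hsplit : EuclideanGeometry.inversion O r (T.points i) - (O + (r ^ 2 / k) • X) =
        (((r / ‖T.points i - O‖) ^ 2 : ℝ) : ℂ) * (T.points i - O) - ((r ^ 2 / k : ℝ) : ℂ) * X := by
      rw [EuclideanGeometry.inversion, vsub_eq_sub, vadd_eq_add, Complex.dist_eq,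
        Complex.real_smul, Complex.real_smul]
      ring
    have hre : (conj (((r ^ 2 / k : ℝ) : ℂ) * X) *
        ((((r / ‖T.points i - O‖) ^ 2 : ℝ) : ℂ) * (T.points i - O))).re =
        (r ^ 2 / k) * (r / ‖T.points i - O‖) ^ 2 * (conj X * (T.points i - O)).re := by
      rw [map_mul, Complex.conj_ofReal, mul_mul_mul_comm, ← Complex.ofReal_mul,
        Complex.re_ofReal_mul]
    have hP' : 2 * (conj X * (T.points i - O)).re = ‖T.points i - O‖ ^ 2 + k := by
      linarith [hP i]
    rw [hsplit, norm_sub_sq_eq, hre, norm_mul, norm_mul, Complex.norm_real, Complex.norm_real,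
      mul_pow, mul_pow, Real.norm_eq_abs, Real.norm_eq_abs, sq_abs, sq_abs, mul_left_comm 2, hP']
    field_simp
    ring
  have hcosph : EuclideanGeometry.Cospherical
      (Set.range fun i => EuclideanGeometry.inversion O r (T.points i)) :=
    ⟨O + (r ^ 2 / k) • X, _, Set.forall_mem_range.mpr hdist⟩
  -- Three distinct concyclic points are never collinear.
  let T' : Affine.Triangle ℝ ℂ := ⟨fun i => EuclideanGeometry.inversion O r (T.points i),
    hcosph.affineIndependent subset_rfl
      ((EuclideanGeometry.inversion_injective O hr.ne').comp T.independent.injective)⟩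
  refine ⟨T', fun i => ⟨hne i, rfl⟩, ?_⟩
  refine (T'.eq_circumcenter_of_dist_eq ?_ hdist).symm
  rw [affineSpan_triangle_eq_top]; trivial

theorem IsInversiveTriangle.unique {O : ℂ} {r : ℝ} {T T₁ T₂ : Affine.Triangle ℝ ℂ}
    (h₁ : IsInversiveTriangle O r T T₁) (h₂ : IsInversiveTriangle O r T T₂) : T₁ = T₂ :=
  Affine.Simplex.ext fun i => (h₁ i).2.trans (h₂ i).2.symm

end Triangles

/-! ### From Poncelet triangles to a constant power. -/

section Tangency

/-- The tangency condition for the sides of a Poncelet triangle, in the affine frame in which the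
outer ellipse is the unit circle. -/
theorem existsUnique_line_of_ponceletTriangles {A : ℂ ≃ᵃ[ℝ] ℂ} {f g : ℂ} {l : ℝ}
    {E : Set ℂ} {T : Affine.Triangle ℝ ℂ} (hT : T ∈ ponceletTriangles E (A '' focalEllipse f g l))
    {z : Fin 3 → ℂ} (hz : ∀ i, A (z i) = T.points i) {i j : Fin 3} (hij : i ≠ j) :
    ∃! t : ℝ, dist (z i + t * (z j - z i)) f + dist (z i + t * (z j - z i)) g = l := by
  have hlm : ∀ t : ℝ, AffineMap.lineMap (z i) (z j) t = z i + t * (z j - z i) := fun t => by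
    rw [AffineMap.lineMap_apply, vsub_eq_sub, vadd_eq_add, Complex.real_smul, add_comm]
  have hA : ∀ t : ℝ, A (z i + t * (z j - z i)) =
      AffineMap.lineMap (T.points i) (T.points j) t := fun t => by
    rw [← hlm, ← hz, ← hz]
    exact A.toAffineMap.apply_lineMap _ _ _
  obtain ⟨w, ⟨hw1, w', hw2, rfl⟩, hu⟩ := hT.2 i j hij
  obtain ⟨t, ht⟩ := mem_affineSpan_pair_iff_exists_lineMap_eq.mp hw1
  rw [← hA] at ht
  refine ⟨t, ?_, fun s hs => ?_⟩
  · rw [← A.injective ht] at hw2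
    exact hw2
  · have h1 := hu (A (z i + s * (z j - z i)))
      ⟨by rw [hA]; exact AffineMap.lineMap_mem_affineSpan_pair _ _ _, _, hs, rfl⟩
    rw [← ht, hA, hA] at h1
    exact AffineMap.lineMap_injective ℝ (T.independent.injective.ne hij) h1

theorem power_circumsphere_of_ponceletTriangles {A : ℂ ≃ᵃ[ℝ] ℂ} {f g o p q : ℂ} {l : ℝ}
    (hl : dist f g < l) (ho : o + conj o * f * g = f + g) (hpq : ‖p‖ ^ 2 ≠ ‖q‖ ^ 2)
    (hA : ∀ x y, A x - A y = p * (x - y) + q * conj (x - y)) {T : Affine.Triangle ℝ ℂ}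
    (hT : T ∈ ponceletTriangles (A '' Metric.sphere (0 : ℂ) 1) (A '' focalEllipse f g l)) :
    T.circumsphere.power (A o) =
      (‖p‖ ^ 2 + ‖q‖ ^ 2) * (‖o‖ ^ 2 - 1) + 2 * (p * conj q * ((o - f) * (o - g))).re := by
  choose z hz hzT using hT.1
  have hz1 : ∀ i, z i * conj (z i) = 1 := fun i => by
    rw [Complex.mul_conj', mem_sphere_zero_iff_norm.mp (hz i)]; simp
  have hinj : ∀ {i j}, i ≠ j → z i ≠ z j := fun {i j} hij h =>
    T.independent.injective.ne hij (by rw [← hzT, ← hzT, h])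
  have htan : ∀ {i j}, i ≠ j → ‖z i + z j - z i * z j * conj f - g‖ = l := fun {i j} hij =>
    norm_reflection_sub_of_tangent (hz1 i) (hz1 j) (hinj hij) hl
      (existsUnique_line_of_ponceletTriangles hT hzT hij)
  have hrel : ∀ {i j k}, i ≠ j → i ≠ k → j ≠ k →
      z j * z k * ((1 - z i * conj f) * (1 - z i * conj g)) = (z i - f) * (z i - g) :=
    fun {i j k} hij hik hjk => blaschke_relation (hz1 i) (hz1 j) (hz1 k) (hinj hjk)
      (htan hij) (htan hik)
  set lam := z 0 * z 1 * z 2 with hlam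
  -- On the unit circle `lam * conj (z i)` is the product of the other two vertices.
  have hB : ∀ i, lam * conj (z i) * ((1 - z i * conj f) * (1 - z i * conj g)) =
      (z i - f) * (z i - g) := fun i => by
    obtain rfl | rfl | rfl := (show ∀ i : Fin 3, i = 0 ∨ i = 1 ∨ i = 2 by decide) i
    · rw [← hrel (i := 0) (j := 1) (k := 2) (by decide) (by decide) (by decide), hlam]
      linear_combination z 1 * z 2 * ((1 - z 0 * conj f) * (1 - z 0 * conj g)) * hz1 0
    · rw [← hrel (i := 1) (j := 0) (k := 2) (by decide) (by decide) (by decide), hlam]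
      linear_combination z 0 * z 2 * ((1 - z 1 * conj f) * (1 - z 1 * conj g)) * hz1 1
    · rw [← hrel (i := 2) (j := 0) (k := 1) (by decide) (by decide) (by decide), hlam]
      linear_combination z 0 * z 1 * ((1 - z 2 * conj f) * (1 - z 2 * conj g)) * hz1 2
  -- `X` will be the circumcenter relative to `A o`. The equation is real-linear in `X`, solvable
  -- since `|p|² - |q|² ≠ 0`.
  obtain ⟨X, hX⟩ : ∃ X : ℂ, conj X * p + X * conj q =
      p * conj q * (f + g + lam * (conj f * conj g)) +
      conj p * q * conj lam - (p * conj p + q * conj q) * conj o - 2 * (p * conj q) * o := by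
    generalize p * conj q * (f + g + lam * (conj f * conj g)) +
      conj p * q * conj lam - (p * conj p + q * conj q) * conj o - 2 * (p * conj q) * o = M
    have hD : p * conj p - q * conj q ≠ 0 := by
      rw [Complex.mul_conj', Complex.mul_conj', sub_ne_zero]
      exact_mod_cast hpq
    refine ⟨(p * conj M - q * M) / (p * conj p - q * conj q), ?_⟩
    have hc : conj (p * conj p - q * conj q) = p * conj p - q * conj q := by
      simp only [map_sub, map_mul, Complex.conj_conj]; ring
    rw [map_div₀, hc]
    simp only [map_sub, map_mul, Complex.conj_conj]
    rw [div_mul_eq_mul_div, div_mul_eq_mul_div, ← add_div, div_eq_iff hD]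
    ring
  refine power_circumsphere_eq T (X := X) fun i => ?_
  rw [← hzT, hA]
  exact circle_equation ho (hz1 i) (hB i) hX

end Tangency

/-! ### The main theorem. -/

theorem mainTheorem6
    (A : ℂ ≃ᵃ[ℝ] ℂ) (f g : ℂ) (l : ℝ) (hl : dist f g < l)
    (E E' : Set ℂ)
    (hE : E = A '' Metric.sphere (0 : ℂ) 1)
    (hE' : E' = A '' focalEllipse f g l)
    (hnested : E' ⊆ A '' Metric.ball (0 : ℂ) 1)
    (hPoncelet : (ponceletTriangles E E').Nonempty)
    (O : ℂ) (hO : O = pointP3 A f g) :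
    ∃ Pi3 : ℝ, Pi3 ≠ 0 ∧
      (∀ T ∈ ponceletTriangles E E', T.circumsphere.power O = Pi3) ∧
      ∀ r : ℝ, 0 < r → ∃ s : ℝ, 1 / s = Pi3 / r ^ 2 ∧ s ≠ 0 ∧
        (∀ T ∈ ponceletTriangles E E', ∃ T' : Affine.Triangle ℝ ℂ,
          IsInversiveTriangle O r T T' ∧
          T'.circumcenter = O + s • (T.circumcenter - O)) ∧
        inversiveCircumcenterLocus O r (ponceletTriangles E E') =
          AffineMap.homothety O s '' circumcenterLocus (ponceletTriangles E E') := by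
  subst hE hE'
  have hball : focalEllipse f g l ⊆ Metric.ball (0 : ℂ) 1 :=
    (Set.image_subset_image_iff A.injective).mp hnested
  have hf := norm_focus_lt_one hl hball
  have hg : ‖g‖ < 1 := norm_focus_lt_one (f := g) (g := f) (l := l) (by rwa [dist_comm])
    fun z hz => hball ((add_comm _ _).trans hz)
  obtain ⟨p, q, hpq, hA⟩ := exists_coeff_affineEquiv A
  obtain ⟨o, ho⟩ : ∃ o : ℂ,
    o = (f + g - (conj f + conj g) * f * g) / (1 - (‖f‖ * ‖g‖) ^ 2 : ℝ) := ⟨_, rfl⟩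
  rw [pointP3, ← ho] at hO
  subst hO
  have ho' := add_conj_mul_eq hf hg ho
  have hneg := power_neg hpq (norm_mul_sub_lt hf hg ho')
  have hpow := fun T => power_circumsphere_of_ponceletTriangles (T := T) hl ho' hpq hA
  generalize (‖p‖ ^ 2 + ‖q‖ ^ 2) * (‖o‖ ^ 2 - 1) +
    2 * (p * conj q * ((o - f) * (o - g))).re = k at hneg hpow
  refine ⟨k, hneg.ne, hpow, fun r hr => ?_⟩
  have hex := fun T hT => exists_inversiveTriangle T hneg.ne hr (hpow T hT)
  have hhom : ∀ X : ℂ, AffineMap.homothety (A o) (r ^ 2 / k) X =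
      A o + (r ^ 2 / k) • (X - A o) := fun X => by
    rw [AffineMap.homothety_apply, vsub_eq_sub, vadd_eq_add, add_comm]
  refine ⟨r ^ 2 / k, one_div_div _ _, div_ne_zero (by positivity) hneg.ne, hex, ?_⟩
  ext Y
  constructor
  · rintro ⟨T, hT, T₁, hT₁, rfl⟩
    obtain ⟨T', hT', hc⟩ := hex T hT
    exact ⟨_, ⟨T, hT, rfl⟩, by rw [hhom, hT₁.unique hT', hc]⟩
  · rintro ⟨_, ⟨T, hT, rfl⟩, rfl⟩
    obtain ⟨T', hT', hc⟩ := hex T hT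
    exact ⟨T, hT, T', hT', by rw [hhom, hc]⟩
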